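/- There is an absolute constant $c>0$ such that the following holds for all integers $n\ge 1$ and $m\ge 0$ with $n+m\ge 2$. Let $G=(V,E)$ be a connected simple graph with $n+m$ vertices and let $\nu$ be the number of edges of a maximum matching in $G$. A circuit under $G$ constraint acts on $n+m$ qubits, identified with the vertices of $G$. Its gates are arbitrary single-qubit unitaries and CNOT gates on pairs of qubits joined by an edge of $G$ (in either direction). Its depth is its number of layers, where a layer is a set of gates acting on pairwise disjoint sets of qubits. Given a choice of $n$ vertices as (ordered) input qubits, the remaining $m$ being ancillas, a circuit $C$ prepares an $n$-qubit state $|\psi\rangle$ if $C|0^n\rangle|0^m\rangle=|\psi\rangle|0^m\rangle$, and implements an $n$-qubit unitary $U$ if $C|x\rangle|0^m\rangle=(U|x\rangle)|0^m\rangle$ for all $x\in\{0,1\}^n$. Then: 1. there is an $n$-qubit state $|\psi\rangle$ such that, for every choice of the input qubits, every circuit under $G$ constraint that prepares $|\psi\rangle$ has depth at least $c\max\{n,2^n/\nu\}$; 2. there is an $n$-qubit diagonal unitary matrix $\Lambda$, with entry $1$ at $(0^n,0^n)$, such that, for every choice of the input qubits, every circuit under $G$ constraint that implements $\Lambda$ has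 depth at least $c\max\{n,2^n/\nu\}$; 3. there is an $n$-qubit unitary $U$ such that, for every choice of the input qubits, every circuit under $G$ constraint that implements $U$ has depth at least $c\max\{n,4^n/\nu\}$. -/

import Mathlib

namespace QCircuit

/-- A gate of a standard quantum circuit under the constraint graph `G`, whose vertices are the
qubits: an arbitrary single-qubit unitary on a qubit, or a CNOT along an edge of `G`. -/
inductive Gate {V : Type*} (G : SimpleGraph V) : Type _
  | single (v : V) (U : Matrix.unitaryGroup (Fin 2) ℂ) : Gate G
  | cnot (control target : V) (h : G.Adj control target) : Gate G

variable {V : Type*} {G : SimpleGraph V}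

/-- The set of qubits that a gate acts on. -/
def Gate.support : Gate G → Set V
  | .single v _ => {v}
  | .cnot u v _ => {u, v}

/-- The unitary of a gate on all the qubits, in the computational basis (bit strings `V → Fin 2`;
addition in `Fin 2` is exclusive or). -/
def Gate.matrix [Fintype V] [DecidableEq V] :
    Gate G → Matrix (V → Fin 2) (V → Fin 2) ℂ
  | .single v U => Matrix.of fun y x =>
      if ∀ w, w ≠ v → y w = x w then (U : Matrix (Fin 2) (Fin 2) ℂ) (y v) (x v) else 0
  | .cnot u v _ => Matrix.of fun y x => if y = Function.update x v (x u + x v) then 1 else 0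

/-- A layer (depth-1 circuit): finitely many gates acting on pairwise disjoint sets of qubits. -/
structure Layer {V : Type*} (G : SimpleGraph V) where
  gates : List (Gate G)
  disjoint : gates.Pairwise fun g h => Disjoint g.support h.support

/-- The unitary of a layer. Its gates commute, so the order of the factors is immaterial. -/
def Layer.matrix [Fintype V] [DecidableEq V] (L : Layer G) :
    Matrix (V → Fin 2) (V → Fin 2) ℂ :=
  (L.gates.map Gate.matrix).prod

/-- A standard quantum circuit under `G` constraint: a sequence of layers, the first one in the
list being applied first. -/
abbrev Circuit {V : Type*} (G : SimpleGraph V) := List (Layer G)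

/-- The depth of a circuit is its number of layers. -/
def Circuit.depth (C : Circuit G) : ℕ := List.length C

/-- The unitary `L_d ⋯ L_2 L_1` of the circuit with layers `L_1, …, L_d`. -/
def Circuit.matrix [Fintype V] [DecidableEq V] :
    Circuit G → Matrix (V → Fin 2) (V → Fin 2) ℂ
  | [] => 1
  | L :: C => Circuit.matrix C * L.matrix

/-- The basis state `|x⟩` on `n` qubits. -/
def ket {n : ℕ} (x : Fin n → Fin 2) : (Fin n → Fin 2) → ℂ := Pi.single x 1

/-- `ψ` is an `n`-qubit (pure) state: a unit vector in `ℂ^(2^n)`. -/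
def IsState {n : ℕ} (ψ : (Fin n → Fin 2) → ℂ) : Prop :=
  Real.sqrt (∑ x, ‖ψ x‖ ^ 2) = 1

/-- `D` is an `n`-qubit diagonal unitary matrix `diag(1, e^{iθ₁}, …)`. -/
def IsDiagonalUnitary {n : ℕ} (D : Matrix (Fin n → Fin 2) (Fin n → Fin 2) ℂ) : Prop :=
  D ∈ Matrix.unitaryGroup (Fin n → Fin 2) ℂ ∧ D.IsDiag ∧ D 0 0 = 1

/-- The vector `|ψ⟩|0^m⟩` on the qubits `V`, where `e` says which qubits form the input register
(`Sum.inl`) and which are the ancillas (`Sum.inr`). -/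
def withAncilla {n m : ℕ} (e : Fin n ⊕ Fin m ≃ V) (ψ : (Fin n → Fin 2) → ℂ) :
    (V → Fin 2) → ℂ :=
  fun z => if ∀ j, z (e (Sum.inr j)) = 0 then ψ (fun i => z (e (Sum.inl i))) else 0

/-- `C |0^n⟩|0^m⟩ = |ψ⟩|0^m⟩`. -/
def Prepares {n m : ℕ} [Fintype V] [DecidableEq V] (e : Fin n ⊕ Fin m ≃ V) (C : Circuit G)
    (ψ : (Fin n → Fin 2) → ℂ) : Prop :=
  (Circuit.matrix C).mulVec (withAncilla e (ket 0)) = withAncilla e ψ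

/-- `C |x⟩|0^m⟩ = (U|x⟩)|0^m⟩` for all `x ∈ {0,1}^n`. -/
def Implements {n m : ℕ} [Fintype V] [DecidableEq V] (e : Fin n ⊕ Fin m ≃ V) (C : Circuit G)
    (U : Matrix (Fin n → Fin 2) (Fin n → Fin 2) ℂ) : Prop :=
  ∀ x, (Circuit.matrix C).mulVec (withAncilla e (ket x)) = withAncilla e (U.mulVec (ket x))

/-- `ν` is the size (number of edges) of a maximum matching in `G`. -/
def IsMaximumMatchingSize {V : Type*} (G : SimpleGraph V) (ν : ℕ) : Prop :=
  IsGreatest {k : ℕ | ∃ M : G.Subgraph, M.IsMatching ∧ M.edgeSet.encard = k} ν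

end QCircuit

/-!
The proof counts parameters by transcendence degree over `ℚ`.

Let `C` be a circuit of depth `d`. In the Heisenberg picture, an operator `O` on the input register
is pulled back to `Cᴴ O C`, one gate at a time, beginning with the last gate. A gate that does not
touch the current support `S` (the light cone) cancels. A single-qubit gate on `S` is merged into a
pending product operator `tensor W`, which costs nothing. Only a CNOT that touches `S` enlarges `S`,
by at most one qubit, and turns the pending operators on its two qubits into parameters: their
entries and conjugates, `16` numbers. This is `ReducesTo` with its three steps
`ReducesTo.mul_gate_of_disjoint`, `ReducesTo.mul_single` and `ReducesTo.mul_cnot`.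

The CNOTs of a layer form a matching, so at most `ν` of them count in each layer; gates in a layer
are disjoint, so at most `|S|` count and `|S|` at most doubles. Hence the number `r` of CNOTs
that count satisfies `r ≤ ν d` and `n + r ≤ n 2 ^ d` (`Circuit.reducesTo`). Matrix elements of
`Cᴴ |a⟩⟨b| C` are products of an output amplitude and a conjugate one. Counting also the operators
that are pending on `S` at the end, `8 |S| ≤ 8 (n + r)` numbers, and the inverse of one conjugate
amplitude, all the amplitudes lie in a ring generated by `24 r + 8 n + 1` numbers
(`exists_finset_forall_amplitude_mem_adjoin`).

The targets are built from algebraically independent real numbers, `2 ^ n` or `4 ^ n` many, that can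
be recovered rationally from the amplitudes with the help of `i` and one more number. For states and
diagonal unitaries the amplitudes are Cayley transforms `(1 + it) / (1 - it)` up to a common factor;
the general unitary is the Cayley transform of a Hermitian matrix. So `2 ^ n` or `4 ^ n` is at most
`24 r + 8 n + 3`. With `r ≤ ν d` this gives the bounds `2 ^ n / ν` and `4 ^ n / ν`, and with
`n + r ≤ n 2 ^ d` the bound `n`, up to constants (`le_depth_of_le_params`); the additive `8 n + 3`
only matters for small `n`, where it suffices that the targets cannot be reached with depth `0`. One
target works for all graphs, since the argument does not depend on the circuit's structure.
-/

namespace QCircuit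

open scoped Matrix

/-! ### Local operators -/

section LocalOperators

variable {V : Type*} [Fintype V]

/-- The tensor product over all the qubits of the `2 × 2` matrices `W v`. -/
def tensor (W : V → Matrix (Fin 2) (Fin 2) ℂ) : Matrix (V → Fin 2) (V → Fin 2) ℂ :=
  Matrix.of fun y x => ∏ v, W v (y v) (x v)

lemma tensor_apply (W : V → Matrix (Fin 2) (Fin 2) ℂ) (y x : V → Fin 2) :
    tensor W y x = ∏ v, W v (y v) (x v) := rfl

lemma tensor_one [DecidableEq V] : tensor (1 : V → Matrix (Fin 2) (Fin 2) ℂ) = 1 := by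
  ext y x
  rw [tensor_apply, Matrix.one_apply]
  split_ifs with h
  · refine Finset.prod_eq_one fun v _ => ?_
    rw [Pi.one_apply, h, Matrix.one_apply_eq]
  · obtain ⟨v, hv⟩ := Function.ne_iff.1 h
    refine Finset.prod_eq_zero (Finset.mem_univ v) ?_
    rw [Pi.one_apply, Matrix.one_apply_ne hv]

lemma tensor_mul [DecidableEq V] (W W' : V → Matrix (Fin 2) (Fin 2) ℂ) :
    tensor W * tensor W' = tensor (W * W') := by
  ext y x
  simp only [Matrix.mul_apply, tensor_apply, Pi.mul_apply, ← Finset.prod_mul_distrib]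
  rw [Finset.prod_univ_sum]
  simp

lemma tensor_conjTranspose (W : V → Matrix (Fin 2) (Fin 2) ℂ) :
    (tensor W)ᴴ = tensor fun v => (W v)ᴴ := by
  ext y x
  simp [tensor_apply, Matrix.conjTranspose_apply]

variable [DecidableEq V]

lemma tensor_commute {W W' : V → Matrix (Fin 2) (Fin 2) ℂ} (h : ∀ v, Commute (W v) (W' v)) :
    Commute (tensor W) (tensor W') := by
  have : W * W' = W' * W := funext fun v => h v
  rw [commute_iff_eq, tensor_mul, tensor_mul, this]

/-- `M` acts only on the qubits in `S`, encoded as membership in the commutant: `M` commutes with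
all product operators on the other qubits. -/
def IsSupportedOn (S : Set V) (M : Matrix (V → Fin 2) (V → Fin 2) ℂ) : Prop :=
  ∀ W : V → Matrix (Fin 2) (Fin 2) ℂ, (∀ v ∈ S, W v = 1) → Commute (tensor W) M

lemma IsSupportedOn.mono {S S' : Set V} {M : Matrix (V → Fin 2) (V → Fin 2) ℂ}
    (hM : IsSupportedOn S M) (h : S ⊆ S') : IsSupportedOn S' M :=
  fun W hW => hM W fun v hv => hW v (h hv)

lemma IsSupportedOn.mul {S : Set V} {M N : Matrix (V → Fin 2) (V → Fin 2) ℂ}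
    (hM : IsSupportedOn S M) (hN : IsSupportedOn S N) : IsSupportedOn S (M * N) :=
  fun W hW => (hM W hW).mul_right (hN W hW)

lemma IsSupportedOn.add {S : Set V} {M N : Matrix (V → Fin 2) (V → Fin 2) ℂ}
    (hM : IsSupportedOn S M) (hN : IsSupportedOn S N) : IsSupportedOn S (M + N) :=
  fun W hW => (hM W hW).add_right (hN W hW)

lemma IsSupportedOn.conjTranspose {S : Set V} {M : Matrix (V → Fin 2) (V → Fin 2) ℂ}
    (hM : IsSupportedOn S M) : IsSupportedOn S Mᴴ := by
  intro W hW
  have h := hM (fun v => (W v)ᴴ) fun v hv => by simp [hW v hv]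
  rw [← tensor_conjTranspose] at h
  have h' := congrArg Matrix.conjTranspose h.eq
  simp only [Matrix.conjTranspose_mul, Matrix.conjTranspose_conjTranspose] at h'
  exact h'.symm

lemma isSupportedOn_tensor {S : Set V} {W : V → Matrix (Fin 2) (Fin 2) ℂ}
    (hW : ∀ v ∉ S, W v = 1) : IsSupportedOn S (tensor W) := by
  intro W' hW'
  refine tensor_commute fun v => ?_
  by_cases hv : v ∈ S
  · rw [hW' v hv]; exact Commute.one_left _
  · rw [hW v hv]; exact Commute.one_right _

end LocalOperators

/-! ### Gates as local operators -/

section Gates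

variable {V : Type*} [Fintype V] [DecidableEq V] {G : SimpleGraph V}

lemma Gate.matrix_single (v : V) (U : Matrix.unitaryGroup (Fin 2) ℂ) :
    (Gate.single v U : Gate G).matrix
      = tensor (Pi.mulSingle v (U : Matrix (Fin 2) (Fin 2) ℂ)) := by
  ext y x
  rw [tensor_apply, ← Finset.mul_prod_erase _ _ (Finset.mem_univ v), Pi.mulSingle_eq_same]
  have : ∀ w ∈ Finset.univ.erase v,
      (Pi.mulSingle v (U : Matrix (Fin 2) (Fin 2) ℂ) : V → Matrix (Fin 2) (Fin 2) ℂ) w (y w) (x w)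
        = if y w = x w then 1 else 0 := by
    intro w hw
    rw [Pi.mulSingle_eq_of_ne (Finset.ne_of_mem_erase hw), Matrix.one_apply]
  rw [Finset.prod_congr rfl this, Finset.prod_ite_zero]
  simp [Gate.matrix]

/-- `CNOT = |0⟩⟨0| ⊗ 1 + |1⟩⟨1| ⊗ X`. -/
lemma Gate.matrix_cnot (u v : V) (h : G.Adj u v) :
    (Gate.cnot u v h : Gate G).matrix
      = tensor (Pi.mulSingle u (Matrix.single 0 0 1)) +
        tensor (Pi.mulSingle u (Matrix.single 1 1 1) * Pi.mulSingle v !![0, 1; 1, 0]) := by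
  have huv : u ≠ v := h.ne
  ext y x
  have key : ∀ A B : Matrix (Fin 2) (Fin 2) ℂ,
      tensor (Pi.mulSingle u A * Pi.mulSingle v B) y x
        = A (y u) (x u) * (B (y v) (x v) *
          if ∀ w, w ≠ u → w ≠ v → y w = x w then 1 else 0) := by
    intro A B
    rw [tensor_apply, ← Finset.mul_prod_erase _ _ (Finset.mem_univ u),
      ← Finset.mul_prod_erase _ _ (Finset.mem_erase.2 ⟨huv.symm, Finset.mem_univ v⟩)]
    have : ∀ w ∈ (Finset.univ.erase u).erase v,
        (Pi.mulSingle u A * Pi.mulSingle v B : V → Matrix (Fin 2) (Fin 2) ℂ) w (y w) (x w)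
          = if y w = x w then 1 else 0 := by
      intro w hw
      have h1 := Finset.ne_of_mem_erase hw
      have h2 := Finset.ne_of_mem_erase (Finset.mem_of_mem_erase hw)
      rw [Pi.mul_apply, Pi.mulSingle_eq_of_ne h2, Pi.mulSingle_eq_of_ne h1, one_mul,
        Matrix.one_apply]
    rw [Finset.prod_congr rfl this, Finset.prod_ite_zero]
    simp only [Pi.mul_apply, Pi.mulSingle_eq_same, Pi.mulSingle_eq_of_ne huv,
      Pi.mulSingle_eq_of_ne huv.symm, one_mul, mul_one, Finset.prod_const_one]
    congr 2
    simp only [Finset.mem_erase, Finset.mem_univ, and_true]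
    congr 1
    exact propext ⟨fun H w hu hv => H w ⟨hv, hu⟩, fun H w hw => H w hw.2 hw.1⟩
  have key1 := key (Matrix.single 0 0 1) 1
  rw [Pi.mulSingle_one, mul_one] at key1
  rw [Matrix.add_apply, key, key1]
  have hy : y = Function.update x v (x u + x v) ↔
      y u = x u ∧ y v = x u + x v ∧ ∀ w, w ≠ u → w ≠ v → y w = x w := by
    rw [Function.eq_update_iff]
    constructor
    · rintro ⟨h1, h2⟩
      exact ⟨h2 u huv, h1, fun w _ hw => h2 w hw⟩
    · rintro ⟨h1, h2, h3⟩
      refine ⟨h2, fun w hw => ?_⟩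
      by_cases hwu : w = u
      · rw [hwu, h1]
      · exact h3 w hwu hw
  simp only [Gate.matrix, Matrix.of_apply, hy]
  by_cases hr : ∀ w, w ≠ u → w ≠ v → y w = x w
  · rw [if_pos hr, mul_one, mul_one]
    simp only [eq_true hr, and_true]
    clear hr hy key key1
    generalize y u = a
    generalize x u = b
    generalize y v = c
    generalize x v = d
    fin_cases a <;> fin_cases b <;> fin_cases c <;> fin_cases d <;>
      simp [Matrix.single]
  · simp [hr]

lemma Gate.isSupportedOn_matrix (g : Gate G) : IsSupportedOn g.support g.matrix := by
  cases g with
  | single v U =>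
    rw [Gate.matrix_single]
    exact isSupportedOn_tensor fun w hw => Pi.mulSingle_eq_of_ne hw _
  | cnot u v h =>
    rw [Gate.matrix_cnot]
    refine IsSupportedOn.add (isSupportedOn_tensor fun w hw => ?_)
      (isSupportedOn_tensor fun w hw => ?_)
    · exact Pi.mulSingle_eq_of_ne (fun h' => hw (Or.inl h')) _
    · rw [Pi.mul_apply, Pi.mulSingle_eq_of_ne (fun h' => hw (Or.inl h')),
        Pi.mulSingle_eq_of_ne (fun h' => hw (Or.inr h')), one_mul]

lemma Gate.conjTranspose_matrix_mul_self (g : Gate G) : g.matrixᴴ * g.matrix = 1 := by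
  cases g with
  | single v U =>
    rw [Gate.matrix_single, tensor_conjTranspose, tensor_mul, ← tensor_one]
    congr 1
    funext w
    by_cases hw : w = v
    · subst hw
      simpa [Matrix.star_eq_conjTranspose] using Matrix.UnitaryGroup.star_mul_self U
    · simp [Pi.mulSingle_eq_of_ne hw]
  | cnot u v h =>
    ext y x
    have hinj : Function.update x v (x u + x v) = Function.update y v (y u + y v) ↔ y = x := by
      refine ⟨fun H => ?_, fun H => by rw [H]⟩
      have hu : x u = y u := by simpa [h.ne] using congrFun H u
      funext w
      have hw := congrFun H w
      by_cases hwv : w = v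
      · subst hwv
        simpa [hu, eq_comm] using hw
      · simpa [hwv, eq_comm] using hw
    simp [Gate.matrix, Matrix.mul_apply, Matrix.one_apply, hinj]

/-- An operator commutes with the gates outside its support. -/
lemma IsSupportedOn.commute_gate {S : Set V} {M : Matrix (V → Fin 2) (V → Fin 2) ℂ}
    (hM : IsSupportedOn S M) {g : Gate G} (hg : Disjoint g.support S) :
    Commute g.matrix M := by
  cases g with
  | single v U =>
    rw [Gate.matrix_single]
    refine hM _ fun w hw => Pi.mulSingle_eq_of_ne (fun h => ?_) _
    exact Set.disjoint_left.1 hg (show w ∈ ({v} : Set V) from h) hw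
  | cnot u v h =>
    rw [Gate.matrix_cnot]
    have hu : ∀ w ∈ S, w ≠ u := fun w hw h =>
      Set.disjoint_left.1 hg (show w ∈ ({u, v} : Set V) from Or.inl h) hw
    have hv : ∀ w ∈ S, w ≠ v := fun w hw h =>
      Set.disjoint_left.1 hg (show w ∈ ({u, v} : Set V) from Or.inr h) hw
    refine Commute.add_left (hM _ fun w hw => ?_) (hM _ fun w hw => ?_)
    · exact Pi.mulSingle_eq_of_ne (hu w hw) _
    · rw [Pi.mul_apply, Pi.mulSingle_eq_of_ne (hu w hw), Pi.mulSingle_eq_of_ne (hv w hw), one_mul]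

end Gates

/-! ### Rings containing the entries -/

section Entries

variable {V : Type*} [Fintype V]

/-- All the entries of `M` belong to `K`. -/
def HasEntriesIn {ι κ : Type*} (K : Subalgebra ℚ ℂ) (M : Matrix ι κ ℂ) : Prop :=
  ∀ y x, M y x ∈ K

lemma HasEntriesIn.mul {ι κ μ : Type*} [Fintype κ] {K : Subalgebra ℚ ℂ} {M : Matrix ι κ ℂ}
    {N : Matrix κ μ ℂ} (hM : HasEntriesIn K M) (hN : HasEntriesIn K N) :
    HasEntriesIn K (M * N) :=
  fun y x => Subalgebra.sum_mem _ fun z _ => Subalgebra.mul_mem _ (hM y z) (hN z x)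

lemma HasEntriesIn.mono {ι κ : Type*} {K K' : Subalgebra ℚ ℂ} {M : Matrix ι κ ℂ}
    (hM : HasEntriesIn K M) (h : K ≤ K') : HasEntriesIn K' M :=
  fun y x => h (hM y x)

lemma hasEntriesIn_one {ι : Type*} [DecidableEq ι] (K : Subalgebra ℚ ℂ) :
    HasEntriesIn K (1 : Matrix ι ι ℂ) := by
  intro y x
  rw [Matrix.one_apply]
  split_ifs
  · exact one_mem K
  · exact zero_mem K

lemma hasEntriesIn_tensor {K : Subalgebra ℚ ℂ} {W : V → Matrix (Fin 2) (Fin 2) ℂ}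
    (hW : ∀ v, HasEntriesIn K (W v)) : HasEntriesIn K (tensor W) :=
  fun y x => Subalgebra.prod_mem _ fun v _ => hW v (y v) (x v)

lemma hasEntriesIn_cnot [DecidableEq V] {G : SimpleGraph V} (K : Subalgebra ℚ ℂ) (u v : V)
    (h : G.Adj u v) : HasEntriesIn K (Gate.cnot u v h : Gate G).matrix := by
  intro y x
  rw [Gate.matrix, Matrix.of_apply]
  split_ifs
  · exact one_mem K
  · exact zero_mem K

lemma hasEntriesIn_conjTranspose_cnot [DecidableEq V] {G : SimpleGraph V} (K : Subalgebra ℚ ℂ)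
    (u v : V) (h : G.Adj u v) : HasEntriesIn K ((Gate.cnot u v h : Gate G).matrix)ᴴ := by
  intro y x
  rw [Matrix.conjTranspose_apply, Gate.matrix, Matrix.of_apply]
  split_ifs
  · simp
  · simp

/-- The entries of a `2 × 2` matrix and their complex conjugates. -/
noncomputable def params (A : Matrix (Fin 2) (Fin 2) ℂ) : Finset ℂ :=
  (Finset.univ.image fun p : Fin 2 × Fin 2 => A p.1 p.2) ∪
    Finset.univ.image fun p : Fin 2 × Fin 2 => star (A p.1 p.2)

lemma card_params_le (A : Matrix (Fin 2) (Fin 2) ℂ) : (params A).card ≤ 8 :=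
  (Finset.card_union_le _ _).trans
    (add_le_add Finset.card_image_le Finset.card_image_le)

lemma hasEntriesIn_adjoin_params {A : Matrix (Fin 2) (Fin 2) ℂ} {T : Set ℂ}
    (hT : (params A : Set ℂ) ⊆ T) : HasEntriesIn (Algebra.adjoin ℚ T) A := fun i j =>
  Algebra.subset_adjoin (hT (Finset.mem_coe.2 (Finset.mem_union_left _
    (Finset.mem_image.2 ⟨(i, j), Finset.mem_univ _, rfl⟩))))

lemma hasEntriesIn_conjTranspose_adjoin_params {A : Matrix (Fin 2) (Fin 2) ℂ} {T : Set ℂ}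
    (hT : (params A : Set ℂ) ⊆ T) : HasEntriesIn (Algebra.adjoin ℚ T) Aᴴ := fun i j =>
  Algebra.subset_adjoin (hT (Finset.mem_coe.2 (Finset.mem_union_right _
    (Finset.mem_image.2 ⟨(j, i), Finset.mem_univ _, rfl⟩))))

end Entries

/-! ### Pulling operators back through gates -/

section Reduction

variable {V : Type*} [Fintype V] [DecidableEq V] {G : SimpleGraph V}

/-- In the Heisenberg picture, `B` turns every rational operator `O` on `S₀` into an operator on `S`
whose entries depend on `16 r` numbers, up to pending single-qubit operators `W` on `S`. Neither the
numbers `T` nor `W` depend on `O`. -/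
def ReducesTo (B : Matrix (V → Fin 2) (V → Fin 2) ℂ) (S₀ S : Finset V) (r : ℕ) : Prop :=
  ∃ (W : V → Matrix (Fin 2) (Fin 2) ℂ) (T : Finset ℂ), (∀ v ∉ S, W v = 1) ∧ T.card ≤ 16 * r ∧
    ∀ O : Matrix (V → Fin 2) (V → Fin 2) ℂ, IsSupportedOn (S₀ : Set V) O → HasEntriesIn ⊥ O →
      ∃ M : Matrix (V → Fin 2) (V → Fin 2) ℂ, IsSupportedOn (S : Set V) M ∧
        HasEntriesIn (Algebra.adjoin ℚ (T : Set ℂ)) M ∧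
        Bᴴ * O * B = (tensor W)ᴴ * M * tensor W

lemma reducesTo_one (S : Finset V) : ReducesTo 1 S S 0 := by
  refine ⟨1, ∅, fun _ _ => rfl, by simp, fun O hS hO => ⟨O, hS, hO.mono bot_le, ?_⟩⟩
  rw [tensor_one]

lemma conjTranspose_mul_mul_mul_assoc {ι : Type*} [Fintype ι] (B O g : Matrix ι ι ℂ) :
    (B * g)ᴴ * O * (B * g) = gᴴ * (Bᴴ * O * B) * g := by
  simp only [Matrix.conjTranspose_mul, Matrix.mul_assoc]

/-- A gate outside the light cone `S` cancels. -/
lemma ReducesTo.mul_gate_of_disjoint {B : Matrix (V → Fin 2) (V → Fin 2) ℂ} {S₀ S : Finset V}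
    {r : ℕ} (h : ReducesTo B S₀ S r) (g : Gate G) (hg : Disjoint g.support (S : Set V)) :
    ReducesTo (B * g.matrix) S₀ S r := by
  obtain ⟨W, T, hW, hT, H⟩ := h
  refine ⟨W, T, hW, hT, fun O hS hO => ?_⟩
  obtain ⟨M, hMS, hME, hM⟩ := H O hS hO
  refine ⟨M, hMS, hME, ?_⟩
  have hWg : tensor W * g.matrix = g.matrix * tensor W :=
    g.isSupportedOn_matrix W fun v hv => hW v fun hv' => Set.disjoint_left.1 hg hv hv'
  have hMg : g.matrix * M = M * g.matrix := hMS.commute_gate hg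
  rw [conjTranspose_mul_mul_mul_assoc, hM, ← conjTranspose_mul_mul_mul_assoc, hWg,
    conjTranspose_mul_mul_mul_assoc, Matrix.mul_assoc _ M, ← hMg, ← Matrix.mul_assoc _ _ M,
    g.conjTranspose_matrix_mul_self, Matrix.one_mul]

/-- A single-qubit gate in the light cone is absorbed by the pending single-qubit operators. -/
lemma ReducesTo.mul_single {B : Matrix (V → Fin 2) (V → Fin 2) ℂ} {S₀ S : Finset V}
    {r : ℕ} (h : ReducesTo B S₀ S r) {v : V} (hv : v ∈ S) (U : Matrix.unitaryGroup (Fin 2) ℂ) :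
    ReducesTo (B * (Gate.single v U : Gate G).matrix) S₀ S r := by
  obtain ⟨W, T, hW, hT, H⟩ := h
  refine ⟨W * Pi.mulSingle v (U : Matrix (Fin 2) (Fin 2) ℂ), T, fun w hw => ?_, hT,
    fun O hS hO => ?_⟩
  · rw [Pi.mul_apply, hW w hw, Pi.mulSingle_eq_of_ne (ne_of_mem_of_not_mem hv hw).symm, mul_one]
  · obtain ⟨M, hMS, hME, hM⟩ := H O hS hO
    refine ⟨M, hMS, hME, ?_⟩
    rw [conjTranspose_mul_mul_mul_assoc, hM, ← conjTranspose_mul_mul_mul_assoc,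
      Gate.matrix_single, tensor_mul]

/-- A CNOT touching the light cone adds its two qubits to it, and the entries of the operators that
were pending on these qubits (and their conjugates) become parameters. -/
lemma ReducesTo.mul_cnot {B : Matrix (V → Fin 2) (V → Fin 2) ℂ} {S₀ S : Finset V}
    {r : ℕ} (H : ReducesTo B S₀ S r) (u v : V) (h : G.Adj u v) :
    ReducesTo (B * (Gate.cnot u v h : Gate G).matrix) S₀ (S ∪ {u, v}) (r + 1) := by
  obtain ⟨W, T, hW, hT, H⟩ := H
  set g : Gate G := Gate.cnot u v h
  -- `W` is the product of its part `P` on the two qubits and its part `W'` on the others.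
  let P : V → Matrix (Fin 2) (Fin 2) ℂ := fun w => if w = u ∨ w = v then W w else 1
  let W' : V → Matrix (Fin 2) (Fin 2) ℂ := fun w => if w = u ∨ w = v then 1 else W w
  have hPW : W = P * W' := by
    funext w
    by_cases hw : w = u ∨ w = v <;> simp [P, W', hw]
  refine ⟨W', T ∪ (params (W u) ∪ params (W v)), fun w hw => ?_, ?_, fun O hS hO => ?_⟩
  · have hw' : w ∉ S := fun hw' => hw (Finset.mem_union_left _ hw')
    simp [W', hW w hw']
  · have h1 := Finset.card_union_le T (params (W u) ∪ params (W v))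
    have h2 := Finset.card_union_le (params (W u)) (params (W v))
    have h3 := card_params_le (W u)
    have h4 := card_params_le (W v)
    omega
  · obtain ⟨M, hMS, hME, hM⟩ := H O hS hO
    have hgP : IsSupportedOn ((S ∪ {u, v} : Finset V) : Set V) (tensor P * g.matrix) := by
      refine (isSupportedOn_tensor fun w hw => ?_).mul (g.isSupportedOn_matrix.mono ?_)
      · have : ¬ (w = u ∨ w = v) := fun h' => hw (by simp [← or_assoc, h'])
        simp [P, this]
      · intro w hw
        have : w = u ∨ w = v := hw
        simp [← or_assoc, this]
    have hMS' : IsSupportedOn ((S ∪ {u, v} : Finset V) : Set V) M :=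
      hMS.mono (Finset.coe_subset.2 Finset.subset_union_left)
    have hPe : ∀ w, HasEntriesIn
        (Algebra.adjoin ℚ ((T ∪ (params (W u) ∪ params (W v)) : Finset ℂ) : Set ℂ)) (P w) ∧
        HasEntriesIn
        (Algebra.adjoin ℚ ((T ∪ (params (W u) ∪ params (W v)) : Finset ℂ) : Set ℂ)) (P w)ᴴ := by
      intro w
      by_cases hw : w = u ∨ w = v
      · have hsub : (params (W w) : Set ℂ) ⊆
            ((T ∪ (params (W u) ∪ params (W v)) : Finset ℂ) : Set ℂ) := by
          rcases hw with rfl | rfl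
          · intro z hz; simp [Finset.mem_coe.1 hz]
          · intro z hz; simp [Finset.mem_coe.1 hz]
        simp only [P, hw, if_true]
        exact ⟨hasEntriesIn_adjoin_params hsub, hasEntriesIn_conjTranspose_adjoin_params hsub⟩
      · simp only [P, hw, if_false, Matrix.conjTranspose_one]
        exact ⟨hasEntriesIn_one _, hasEntriesIn_one _⟩
    refine ⟨(tensor P * g.matrix)ᴴ * M * (tensor P * g.matrix),
      (hgP.conjTranspose.mul hMS').mul hgP, ?_, ?_⟩
    · refine HasEntriesIn.mul (HasEntriesIn.mul ?_ (hME.mono (Algebra.adjoin_mono ?_))) ?_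
      · rw [Matrix.conjTranspose_mul, tensor_conjTranspose]
        exact (hasEntriesIn_conjTranspose_cnot _ u v h).mul (hasEntriesIn_tensor fun w => (hPe w).2)
      · simp
      · exact (hasEntriesIn_tensor fun w => (hPe w).1).mul (hasEntriesIn_cnot _ u v h)
    · have hWg : tensor W' * g.matrix = g.matrix * tensor W' :=
        g.isSupportedOn_matrix W' fun w hw => if_pos hw
      rw [conjTranspose_mul_mul_mul_assoc, hM, ← conjTranspose_mul_mul_mul_assoc, hPW, ← tensor_mul,
        Matrix.mul_assoc (tensor P), hWg, ← Matrix.mul_assoc (tensor P),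
        conjTranspose_mul_mul_mul_assoc]

end Reduction

/-! ### Counting the CNOTs in the light cone -/

section Counting

variable {V : Type*} {G : SimpleGraph V}

/-- Whether a gate is a CNOT. -/
def Gate.isCnot : Gate G → Bool
  | .single _ _ => false
  | .cnot _ _ _ => true

/-- The CNOT gates of a layer form a matching. -/
lemma exists_isMatching_of_pairwise_disjoint (gs : List (Gate G))
    (h : gs.Pairwise fun g h => Disjoint g.support h.support) :
    ∃ M : G.Subgraph, M.IsMatching ∧ M.edgeSet.encard = gs.countP Gate.isCnot ∧
      ∀ v ∈ M.verts, ∃ g ∈ gs, v ∈ g.support := by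
  induction gs with
  | nil =>
    exact ⟨⊥, fun v hv => by simp at hv, by simp, fun v hv => by simp at hv⟩
  | cons g gs ih =>
    obtain ⟨hg, hgs⟩ := List.pairwise_cons.1 h
    obtain ⟨M, hM, hcard, hverts⟩ := ih hgs
    cases g with
    | single v U =>
      refine ⟨M, hM, by simpa [Gate.isCnot] using hcard, fun w hw => ?_⟩
      obtain ⟨g', hg', hw'⟩ := hverts w hw
      exact ⟨g', List.mem_cons_of_mem _ hg', hw'⟩
    | cnot u v huv =>
      have hdis : Disjoint (G.subgraphOfAdj huv).verts M.verts := by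
        refine Set.disjoint_left.2 fun w hw hwM => ?_
        obtain ⟨g', hg', hw'⟩ := hverts w hwM
        exact Set.disjoint_left.1 (hg g' hg') (show w ∈ ({u, v} : Set V) from hw) hw'
      refine ⟨G.subgraphOfAdj huv ⊔ M, ?_, ?_, ?_⟩
      · refine (SimpleGraph.Subgraph.IsMatching.subgraphOfAdj huv).sup hM ?_
        rwa [(SimpleGraph.Subgraph.IsMatching.subgraphOfAdj huv).support_eq_verts,
          hM.support_eq_verts]
      · have hedge : s(u, v) ∉ M.edgeSet := fun he =>
          Set.disjoint_left.1 hdis (show u ∈ ({u, v} : Set V) from Or.inl rfl)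
            (M.edge_vert (SimpleGraph.Subgraph.mem_edgeSet.1 he))
        rw [SimpleGraph.Subgraph.edgeSet_sup, SimpleGraph.edgeSet_subgraphOfAdj,
          Set.encard_union_eq (Set.disjoint_singleton_left.2 hedge), hcard,
          Set.encard_singleton, List.countP_cons]
        simp [Gate.isCnot, add_comm]
      · intro w hw
        rcases hw with hw | hw
        · exact ⟨_, List.mem_cons_self, hw⟩
        · obtain ⟨g', hg', hw'⟩ := hverts w hw
          exact ⟨g', List.mem_cons_of_mem _ hg', hw'⟩

lemma Layer.countP_isCnot_le {ν : ℕ} (hν : IsMaximumMatchingSize G ν) (L : Layer G) :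
    L.gates.countP Gate.isCnot ≤ ν := by
  obtain ⟨M, hM, hcard, -⟩ := exists_isMatching_of_pairwise_disjoint L.gates L.disjoint
  exact hν.2 ⟨M, hM, hcard⟩

variable [Fintype V] [DecidableEq V]

open Classical in
/-- Pulling an operator back through pairwise disjoint gates: the number `k` of CNOTs that touch the
light cone `S` is at most the number of qubits of `S` that the gates act on. -/
lemma ReducesTo.mul_prod {S₀ : Finset V} (gs : List (Gate G))
    (h : gs.Pairwise fun g h => Disjoint g.support h.support) :
    ∀ {B : Matrix (V → Fin 2) (V → Fin 2) ℂ} {S : Finset V} {r : ℕ}, ReducesTo B S₀ S r →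
    ∃ (S' : Finset V) (k : ℕ), ReducesTo (B * (gs.map Gate.matrix).prod) S₀ S' (r + k) ∧
      S'.card ≤ S.card + k ∧ k ≤ gs.countP Gate.isCnot ∧
      k ≤ (S.filter fun v => ∃ g ∈ gs, v ∈ g.support).card := by
  induction gs with
  | nil =>
    intro B S r hB
    exact ⟨S, 0, by simpa using hB, by simp, by simp, by simp⟩
  | cons g gs ih =>
    intro B S r hB
    obtain ⟨hg, hgs⟩ := List.pairwise_cons.1 h
    have step : ∃ (S₁ : Finset V) (k : ℕ), ReducesTo (B * g.matrix) S₀ S₁ (r + k) ∧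
        S₁.card ≤ S.card + k ∧ k ≤ (if g.isCnot then 1 else 0) ∧
        k ≤ (S.filter fun v => v ∈ g.support).card ∧ ∀ v ∈ S₁, v ∈ S ∨ v ∈ g.support := by
      by_cases hd : Disjoint g.support (S : Set V)
      · exact ⟨S, 0, hB.mul_gate_of_disjoint g hd, by simp, by simp, by simp, fun v hv => Or.inl hv⟩
      obtain ⟨w, hwg, hwS⟩ := Set.not_disjoint_iff.1 hd
      cases g with
      | single v U =>
        have hwv : w = v := hwg
        exact ⟨S, 0, hB.mul_single (hwv ▸ hwS) U, by simp, by simp, by simp, fun v hv => Or.inl hv⟩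
      | cnot u v huv =>
        refine ⟨S ∪ {u, v}, 1, hB.mul_cnot u v huv, ?_, by simp [Gate.isCnot], ?_, ?_⟩
        · have hsub : ∃ z, S ∪ {u, v} ⊆ insert z S := by
            rcases (show w = u ∨ w = v from hwg) with rfl | rfl
            · refine ⟨v, fun z hz => ?_⟩
              have hwS' : w ∈ S := hwS
              simp only [Finset.mem_union, Finset.mem_insert, Finset.mem_singleton] at hz ⊢
              rcases hz with hz | rfl | rfl <;> simp_all
            · refine ⟨u, fun z hz => ?_⟩
              have hwS' : w ∈ S := hwS
              simp only [Finset.mem_union, Finset.mem_insert, Finset.mem_singleton] at hz ⊢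
              rcases hz with hz | rfl | rfl <;> simp_all
          obtain ⟨z, hz⟩ := hsub
          exact (Finset.card_le_card hz).trans (Finset.card_insert_le _ _)
        · exact Finset.card_pos.2 ⟨w, Finset.mem_filter.2 ⟨hwS, hwg⟩⟩
        · intro z hz
          simp only [Finset.mem_union, Finset.mem_insert, Finset.mem_singleton] at hz
          exact hz
    obtain ⟨S₁, k₁, h1, h2, h3, h4, h5⟩ := step
    obtain ⟨S₂, k₂, i1, i2, i3, i4⟩ := ih hgs h1
    refine ⟨S₂, k₁ + k₂, ?_, by omega, ?_, ?_⟩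
    · rw [List.map_cons, List.prod_cons, ← Matrix.mul_assoc, ← add_assoc]
      exact i1
    · rw [List.countP_cons]
      omega
    · refine (add_le_add h4 i4).trans ?_
      rw [← Finset.card_union_of_disjoint]
      · refine Finset.card_le_card fun z hz => ?_
        simp only [Finset.mem_union, Finset.mem_filter, List.mem_cons, exists_eq_or_imp] at hz ⊢
        rcases hz with ⟨hz, hzg⟩ | ⟨hz, g', hg', hzg'⟩
        · exact ⟨hz, Or.inl hzg⟩
        · refine ⟨(h5 z hz).resolve_right fun hzg => ?_, Or.inr ⟨g', hg', hzg'⟩⟩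
          exact Set.disjoint_left.1 (hg g' hg') hzg hzg'
      · refine Finset.disjoint_left.2 fun z hz hz' => ?_
        simp only [Finset.mem_filter] at hz hz'
        obtain ⟨-, g', hg', hzg'⟩ := hz'
        exact Set.disjoint_left.1 (hg g' hg') hz.2 hzg'

open Classical in
/-- The number `r` of CNOTs in the backward light cone of `S₀` is at most `ν` per layer, and the light
cone at most doubles with every layer. -/
lemma Circuit.reducesTo {ν : ℕ} (hν : IsMaximumMatchingSize G ν) (S₀ : Finset V) (C : Circuit G) :
    ∃ (S : Finset V) (r : ℕ), ReducesTo (Circuit.matrix C) S₀ S r ∧ S.card ≤ S₀.card + r ∧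
      r ≤ ν * C.depth ∧ S₀.card + r ≤ S₀.card * 2 ^ C.depth := by
  induction C with
  | nil => exact ⟨S₀, 0, reducesTo_one S₀, by simp, by simp, by simp [Circuit.depth]⟩
  | cons L C ih =>
    obtain ⟨S, r, h1, h2, h3, h4⟩ := ih
    obtain ⟨S', k, i1, i2, i3, i4⟩ := h1.mul_prod L.gates L.disjoint
    have hkν := i3.trans (L.countP_isCnot_le hν)
    have hkS := i4.trans (Finset.card_filter_le _ _)
    have hdepth : Circuit.depth (L :: C) = Circuit.depth C + 1 := rfl
    refine ⟨S', r + k, i1, by omega, ?_, ?_⟩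
    · rw [hdepth, mul_add, mul_one]
      omega
    · rw [hdepth, pow_succ, ← mul_assoc]
      omega

end Counting

/-! ### The amplitudes on the input register -/

section Amplitudes

variable {V : Type*} {G : SimpleGraph V} {n m : ℕ}

/-- The bit string `x0^m` on the qubits `V`. -/
def padded (e : Fin n ⊕ Fin m ≃ V) (x : Fin n → Fin 2) : V → Fin 2 :=
  fun v => Sum.elim x 0 (e.symm v)

@[simp] lemma padded_inl (e : Fin n ⊕ Fin m ≃ V) (x : Fin n → Fin 2) (i : Fin n) :
    padded e x (e (Sum.inl i)) = x i := by simp [padded]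

@[simp] lemma padded_inr (e : Fin n ⊕ Fin m ≃ V) (x : Fin n → Fin 2) (j : Fin m) :
    padded e x (e (Sum.inr j)) = 0 := by simp [padded]

lemma eq_padded_iff (e : Fin n ⊕ Fin m ≃ V) (x : Fin n → Fin 2) (z : V → Fin 2) :
    z = padded e x ↔ (∀ j, z (e (Sum.inr j)) = 0) ∧ (fun i => z (e (Sum.inl i))) = x := by
  constructor
  · rintro rfl
    simp
  · rintro ⟨h1, rfl⟩
    funext v
    obtain ⟨w, rfl⟩ := e.surjective v
    rcases w with i | j
    · simp
    · simp [h1]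

@[simp] lemma withAncilla_padded (e : Fin n ⊕ Fin m ≃ V) (ψ : (Fin n → Fin 2) → ℂ)
    (x : Fin n → Fin 2) : withAncilla e ψ (padded e x) = ψ x := by
  simp [withAncilla]

lemma withAncilla_injective (e : Fin n ⊕ Fin m ≃ V) : Function.Injective (withAncilla e) :=
  fun ψ φ h => funext fun x => by simpa using congrFun h (padded e x)

variable [Fintype V]

lemma withAncilla_ket [DecidableEq V] (e : Fin n ⊕ Fin m ≃ V) (x : Fin n → Fin 2) :
    withAncilla e (ket x) = Pi.single (padded e x) 1 := by
  funext z
  rw [withAncilla, ket, Pi.single_apply, Pi.single_apply]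
  simp only [eq_padded_iff]
  split_ifs <;> simp_all

/-- The operator `|a⟩⟨b|` on the input register. -/
noncomputable def inputUnit (e : Fin n ⊕ Fin m ≃ V) (a b : Fin n → Fin 2) :
    Matrix (V → Fin 2) (V → Fin 2) ℂ :=
  tensor fun v => Sum.elim (fun i => Matrix.single (a i) (b i) 1) (fun _ => 1) (e.symm v)

lemma inputUnit_apply (e : Fin n ⊕ Fin m ≃ V) (a b : Fin n → Fin 2) (y z : V → Fin 2) :
    inputUnit e a b y z = (∏ i, if a i = y (e (Sum.inl i)) ∧ b i = z (e (Sum.inl i)) then 1 else 0) *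
      ∏ j, if y (e (Sum.inr j)) = z (e (Sum.inr j)) then 1 else 0 := by
  rw [inputUnit, tensor_apply, ← e.prod_comp, Fintype.prod_sum_type]
  simp [Matrix.single_apply, Matrix.one_apply]

variable [DecidableEq V]

lemma star_withAncilla_dotProduct_inputUnit_mulVec (e : Fin n ⊕ Fin m ≃ V) (a b : Fin n → Fin 2)
    (φ φ' : (Fin n → Fin 2) → ℂ) :
    star (withAncilla e φ) ⬝ᵥ (inputUnit e a b *ᵥ withAncilla e φ') = star (φ a) * φ' b := by
  have h1 : ∀ y, (inputUnit e a b *ᵥ withAncilla e φ') y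
      = inputUnit e a b y (padded e b) * φ' b := by
    intro y
    rw [Matrix.mulVec, dotProduct, Fintype.sum_eq_single (padded e b), withAncilla_padded]
    intro z hz
    by_contra hne
    obtain ⟨hO, hA⟩ := mul_ne_zero_iff.1 hne
    refine hz ((eq_padded_iff e b z).2 ⟨?_, ?_⟩)
    · by_contra h
      exact hA (if_neg h)
    · funext i
      rw [inputUnit_apply] at hO
      have := Finset.prod_ne_zero_iff.1 (mul_ne_zero_iff.1 hO).1 i (Finset.mem_univ i)
      by_contra h
      exact this (if_neg fun h' => h h'.2.symm)
  rw [dotProduct, Fintype.sum_eq_single (padded e a), h1, inputUnit_apply]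
  · simp
  · intro y hy
    by_contra hne
    obtain ⟨hA, hO⟩ := mul_ne_zero_iff.1 hne
    rw [h1] at hO
    refine hy ((eq_padded_iff e a y).2 ⟨?_, ?_⟩)
    · by_contra h
      refine hA ?_
      rw [Pi.star_apply, withAncilla, if_neg h, star_zero]
    · funext i
      rw [inputUnit_apply] at hO
      have := Finset.prod_ne_zero_iff.1 (mul_ne_zero_iff.1 (mul_ne_zero_iff.1 hO).1).1 i
        (Finset.mem_univ i)
      by_contra h
      exact this (if_neg fun h' => h h'.1.symm)

/-- Matrix elements of a pulled-back input operator are products of an output amplitude and a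
conjugate one. -/
lemma conjTranspose_mul_inputUnit_mul_apply (e : Fin n ⊕ Fin m ≃ V)
    {B : Matrix (V → Fin 2) (V → Fin 2) ℂ} {x x' : Fin n → Fin 2} {φ φ' : (Fin n → Fin 2) → ℂ}
    (h : B *ᵥ withAncilla e (ket x) = withAncilla e φ)
    (h' : B *ᵥ withAncilla e (ket x') = withAncilla e φ') (a b : Fin n → Fin 2) :
    (Bᴴ * inputUnit e a b * B) (padded e x) (padded e x') = star (φ a) * φ' b := by
  rw [withAncilla_ket, Matrix.mulVec_single_one] at h h'
  rw [← star_withAncilla_dotProduct_inputUnit_mulVec e, ← h, ← h', Matrix.mul_assoc,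
    Matrix.mul_apply']
  congr 1

/-- All the amplitudes that a circuit of depth `d` produces on the input register are polynomials in
`24 r + 8 n + 1` numbers, where `r` is the number of CNOTs in the backward light cone of the
register. -/
lemma exists_finset_forall_amplitude_mem_adjoin {ν : ℕ} (hν : IsMaximumMatchingSize G ν)
    (e : Fin n ⊕ Fin m ≃ V) (C : Circuit G) {X : Set (Fin n → Fin 2)}
    {φ : (Fin n → Fin 2) → (Fin n → Fin 2) → ℂ}
    (h : ∀ x ∈ X, Circuit.matrix C *ᵥ withAncilla e (ket x) = withAncilla e (φ x)) :
    ∃ (r : ℕ) (T : Finset ℂ), r ≤ ν * C.depth ∧ n + r ≤ n * 2 ^ C.depth ∧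
      T.card ≤ 24 * r + 8 * n + 1 ∧
      ∀ x ∈ X, ∀ a, φ x a ∈ Algebra.adjoin ℚ (T : Set ℂ) := by
  have hcard : (Finset.univ.image fun i : Fin n => e (Sum.inl i)).card = n := by
    rw [Finset.card_image_of_injective _ fun i j hij => Sum.inl_injective (e.injective hij),
      Finset.card_fin]
  obtain ⟨S, r, ⟨W, T, hW, hT, H⟩, hS, hr1, hr2⟩ :=
    Circuit.reducesTo hν (Finset.univ.image fun i : Fin n => e (Sum.inl i)) C
  rw [hcard] at hS hr2
  have hO : ∀ a b, IsSupportedOn ((Finset.univ.image fun i : Fin n => e (Sum.inl i) : Finset V) :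
      Set V) (inputUnit e a b) := by
    refine fun a b => isSupportedOn_tensor fun v hv => ?_
    obtain ⟨w, rfl⟩ := e.surjective v
    rcases w with i | j
    · exact absurd (by simp) hv
    · simp
  have hO' : ∀ a b, HasEntriesIn ⊥ (inputUnit e a b) := by
    refine fun a b => hasEntriesIn_tensor fun v i j => ?_
    rcases e.symm v with k | k
    · simp only [Sum.elim_inl, Matrix.single_apply]
      split_ifs
      · exact one_mem _
      · exact zero_mem _
    · exact hasEntriesIn_one _ _ _
  set T₁ : Finset ℂ := T ∪ S.biUnion fun v => params (W v)
  have hT₁ : T₁.card ≤ 16 * r + S.card * 8 :=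
    (Finset.card_union_le _ _).trans
      (add_le_add hT (Finset.card_biUnion_le_card_mul _ _ _ fun v _ => card_params_le _))
  have hWT : ∀ v, HasEntriesIn (Algebra.adjoin ℚ (T₁ : Set ℂ)) (W v) ∧
      HasEntriesIn (Algebra.adjoin ℚ (T₁ : Set ℂ)) (W v)ᴴ := by
    intro v
    by_cases hv : v ∈ S
    · have hsub : (params (W v) : Set ℂ) ⊆ (T₁ : Set ℂ) := Finset.coe_subset.2
        ((Finset.subset_biUnion_of_mem (fun v => params (W v)) hv).trans Finset.subset_union_right)
      exact ⟨hasEntriesIn_adjoin_params hsub, hasEntriesIn_conjTranspose_adjoin_params hsub⟩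
    · rw [hW v hv, Matrix.conjTranspose_one]
      exact ⟨hasEntriesIn_one _, hasEntriesIn_one _⟩
  have key : ∀ x ∈ X, ∀ x' ∈ X, ∀ a b,
      star (φ x a) * φ x' b ∈ Algebra.adjoin ℚ (T₁ : Set ℂ) := by
    intro x hx x' hx' a b
    rw [← conjTranspose_mul_inputUnit_mul_apply e (h x hx) (h x' hx')]
    obtain ⟨M, -, hME, hM⟩ := H _ (hO a b) (hO' a b)
    rw [hM, tensor_conjTranspose]
    exact (((hasEntriesIn_tensor fun v => (hWT v).2).mul
      (hME.mono (Algebra.adjoin_mono (Finset.coe_subset.2 Finset.subset_union_left)))).mul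
        (hasEntriesIn_tensor fun v => (hWT v).1)) _ _
  by_cases hz : ∀ x ∈ X, ∀ a, φ x a = 0
  · exact ⟨r, ∅, hr1, hr2, by simp, fun x hx a => by rw [hz x hx a]; exact zero_mem _⟩
  push Not at hz
  obtain ⟨x₀, hx₀, a₀, hne⟩ := hz
  -- One more number, `1 / conj (φ x₀ a₀)`, isolates the single amplitudes.
  refine ⟨r, insert (star (φ x₀ a₀))⁻¹ T₁, hr1, hr2, ?_, fun x hx a => ?_⟩
  · have := Finset.card_insert_le (star (φ x₀ a₀))⁻¹ T₁
    omega
  · have h1 := Algebra.adjoin_mono (R := ℚ)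
      (Finset.coe_subset.2 (Finset.subset_insert (star (φ x₀ a₀))⁻¹ T₁)) (key x₀ hx₀ x hx a₀ a)
    have h2 : (star (φ x₀ a₀))⁻¹ ∈
        Algebra.adjoin ℚ ((insert (star (φ x₀ a₀))⁻¹ T₁ : Finset ℂ) : Set ℂ) :=
      Algebra.subset_adjoin (Finset.mem_coe.2 (Finset.mem_insert_self _ _))
    have h3 := mul_mem h2 h1
    rwa [inv_mul_cancel_left₀ (star_ne_zero.2 hne)] at h3

end Amplitudes

/-! ### Algebraically independent real numbers -/

section Transcendence

/-- The rank inequality of the algebraic-independence matroid. -/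
lemma card_le_card_of_mem_adjoin {ι : Type*} [Fintype ι] {t : ι → ℂ}
    (ht : AlgebraicIndependent ℚ t) (T : Finset ℂ)
    (h : ∀ i, t i ∈ IntermediateField.adjoin ℚ (T : Set ℂ)) : Fintype.card ι ≤ T.card := by
  have hind : (AlgebraicIndependent.matroid ℚ ℂ).Indep (Set.range t) :=
    AlgebraicIndependent.matroid_indep_iff.2 ht.coe_range
  have hsub : Set.range t ⊆ (AlgebraicIndependent.matroid ℚ ℂ).closure (T : Set ℂ) := by
    rintro _ ⟨i, rfl⟩
    rw [AlgebraicIndependent.matroid_closure_eq]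
    obtain ⟨r, hr, s, hs, hrs⟩ := IntermediateField.mem_adjoin_iff_div.1 (h i)
    rw [hrs, div_eq_mul_inv]
    have alg : ∀ z ∈ Algebra.adjoin ℚ (T : Set ℂ), IsAlgebraic (Algebra.adjoin ℚ (T : Set ℂ)) z :=
      fun z hz => isAlgebraic_algebraMap (⟨z, hz⟩ : Algebra.adjoin ℚ (T : Set ℂ))
    exact (alg r hr).mul (alg s hs).inv
  have := hind.encard_le_eRk_of_subset hsub
  rw [Matroid.eRk_closure_eq] at this
  have := this.trans (Matroid.eRk_le_encard _ _)
  rw [Set.encard_coe_eq_coe_finsetCard, ← Set.image_univ, ht.injective.encard_image,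
    Set.encard_univ, ENat.card_eq_coe_fintype_card] at this
  exact_mod_cast this

/-- There are arbitrarily many algebraically independent real numbers, because a field algebraic over
a finitely generated extension of `ℚ` is countable. -/
lemma exists_algebraicIndependent_real (ι : Type*) [Finite ι] :
    ∃ t : ι → ℝ, AlgebraicIndependent ℚ fun i => (t i : ℂ) := by
  obtain ⟨s, hs⟩ := exists_isTranscendenceBasis ℚ ℝ
  have hinf : Infinite s := by
    by_contra hfin
    rw [not_infinite_iff_finite] at hfin
    have := hs.isAlgebraic
    have h1 := Algebra.IsAlgebraic.cardinalMk_le_max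
      (Algebra.adjoin ℚ (Set.range ((↑) : s → ℝ))) ℝ
    have h2 : Cardinal.mk (Algebra.adjoin ℚ (Set.range ((↑) : s → ℝ))) ≤ Cardinal.aleph0 := by
      rw [← Cardinal.mk_congr hs.1.aevalEquiv.toEquiv]
      refine MvPolynomial.cardinalMk_le_max.trans ?_
      simp
    have h3 := h1.trans (max_le h2 le_rfl)
    rw [Cardinal.mk_real] at h3
    exact absurd h3 (not_le.2 Cardinal.aleph0_lt_continuum)
  have := Fintype.ofFinite ι
  let f : ι → s := fun i => Infinite.natEmbedding s (Fintype.equivFin ι i)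
  have hf : Function.Injective f := fun i j hij =>
    (Fintype.equivFin ι).injective (Fin.val_injective ((Infinite.natEmbedding s).injective hij))
  refine ⟨fun i => f i, ?_⟩
  have h := hs.1.comp f hf
  exact h.map' (f := (Complex.ofRealAm.restrictScalars ℚ : ℝ →ₐ[ℚ] ℂ)) Complex.ofReal_injective

end Transcendence

/-! ### Cayley transforms with recoverable parameters -/

section GenericTargets

open Complex
open scoped ComplexOrder

/-- The Cayley transform of the real number `t`, a point of the unit circle. -/
noncomputable def cayley (t : ℝ) : ℂ := (1 + I * t) / (1 - I * t)

lemma one_sub_I_mul_ne_zero (t : ℝ) : (1 : ℂ) - I * t ≠ 0 := fun h => by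
  simpa using congrArg Complex.re h

lemma norm_cayley (t : ℝ) : ‖cayley t‖ = 1 := by
  have h : (1 : ℂ) + I * t = (starRingEnd ℂ) (1 - I * t) := by simp
  rw [cayley, norm_div, h, RCLike.norm_conj, div_self]
  exact norm_ne_zero_iff.2 (one_sub_I_mul_ne_zero t)

lemma cayley_ne_zero (t : ℝ) : cayley t ≠ 0 := by
  rw [← norm_ne_zero_iff, norm_cayley]
  exact one_ne_zero

lemma cayley_injective : Function.Injective cayley := by
  intro a b h
  rw [cayley, cayley, div_eq_div_iff (one_sub_I_mul_ne_zero a) (one_sub_I_mul_ne_zero b)] at h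
  have h' : (2 * I) * (a : ℂ) = (2 * I) * b := by linear_combination h
  exact ofReal_injective (mul_left_cancel₀ (by simp) h')

/-- The parameter of a Cayley transform is a rational expression in the transform and `i`. -/
lemma ofReal_mem_of_cayley_mem {K : IntermediateField ℚ ℂ} {t : ℝ} (hI : I ∈ K)
    (h : cayley t ∈ K) : (t : ℂ) ∈ K := by
  have h0 := one_sub_I_mul_ne_zero t
  have hu : cayley t + 1 = 2 / (1 - I * t) := by
    rw [cayley]; field_simp; ring
  have hu' : cayley t - 1 = 2 * I * t / (1 - I * t) := by
    rw [cayley]; field_simp; ring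
  have : (t : ℂ) = (cayley t - 1) / (cayley t + 1) / I := by
    have h2 : (1 : ℂ) - t * I ≠ 0 := by rwa [mul_comm]
    rw [hu, hu']; field_simp
  rw [this]
  exact div_mem (div_mem (sub_mem h (one_mem K)) (add_mem h (one_mem K))) hI

variable {ι : Type*}

/-- The matrix with entries `t_ab + t_ba + i (t_ab - t_ba)`; it is Hermitian, and the `t_ab` can be
recovered from it. -/
noncomputable def hermitianOf (t : ι × ι → ℝ) : Matrix ι ι ℂ :=
  Matrix.of fun a b => ((t (a, b) + t (b, a) : ℝ) : ℂ) + I * ((t (a, b) - t (b, a) : ℝ) : ℂ)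

lemma isHermitian_hermitianOf (t : ι × ι → ℝ) : (hermitianOf t)ᴴ = hermitianOf t := by
  ext a b
  simp [hermitianOf, Matrix.conjTranspose_apply]
  ring

lemma ofReal_mem_of_forall_hermitianOf_mem {K : IntermediateField ℚ ℂ} {t : ι × ι → ℝ}
    (hI : I ∈ K) (h : ∀ a b, hermitianOf t a b ∈ K) (p : ι × ι) : (t p : ℂ) ∈ K := by
  obtain ⟨a, b⟩ := p
  have : (t (a, b) : ℂ) = ((hermitianOf t a b + hermitianOf t b a) +
      (hermitianOf t a b - hermitianOf t b a) / I) / 4 := by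
    simp only [hermitianOf, Matrix.of_apply]
    field_simp
    push_cast
    ring
  rw [this]
  exact div_mem (add_mem (add_mem (h a b) (h b a)) (div_mem (sub_mem (h a b) (h b a)) hI))
    (ofNat_mem K 4)

variable [Fintype ι] [DecidableEq ι]

lemma isUnit_one_add_I_smul {H : Matrix ι ι ℂ} (hH : Hᴴ = H) : IsUnit (1 + I • H) := by
  have hpos : (1 + Hᴴ * H).PosDef :=
    Matrix.PosDef.one.add_posSemidef (Matrix.posSemidef_conjTranspose_mul_self H)
  have hfac : (1 + I • H) * (1 - I • H) = 1 + Hᴴ * H := by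
    rw [hH]
    simp only [add_mul, mul_sub, one_mul, mul_one, smul_mul_smul_comm, I_mul_I]
    rw [neg_one_smul]
    abel
  have hu := hpos.isUnit
  rw [← hfac] at hu
  rw [Matrix.isUnit_iff_isUnit_det, Matrix.det_mul] at hu
  rw [Matrix.isUnit_iff_isUnit_det]
  exact isUnit_of_mul_isUnit_left hu

/-- The Cayley transform `(1 - iH)(1 + iH)⁻¹` of a Hermitian matrix `H`. -/
noncomputable def cayleyMatrix (H : Matrix ι ι ℂ) : Matrix ι ι ℂ := (1 - I • H) * (1 + I • H)⁻¹

lemma cayleyMatrix_mem_unitaryGroup {H : Matrix ι ι ℂ} (hH : Hᴴ = H) :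
    cayleyMatrix H ∈ Matrix.unitaryGroup ι ℂ := by
  have hu := (Matrix.isUnit_iff_isUnit_det _).1 (isUnit_one_add_I_smul hH)
  have h1 : (1 + I • H)ᴴ = 1 - I • H := by
    simp [hH, sub_eq_add_neg]
  have h2 : (1 - I • H)ᴴ = 1 + I • H := by
    simp [hH, sub_eq_add_neg]
  have hcomm : (1 + I • H) * (1 - I • H) = (1 - I • H) * (1 + I • H) := by
    simp only [add_mul, mul_add, mul_sub, sub_mul, one_mul, mul_one]
    abel
  have hu' : IsUnit (1 - I • H).det := by
    rw [← h1, Matrix.det_conjTranspose]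
    exact hu.star
  rw [Matrix.mem_unitaryGroup_iff', Matrix.star_eq_conjTranspose, cayleyMatrix,
    Matrix.conjTranspose_mul, Matrix.conjTranspose_nonsing_inv, h1, h2, Matrix.mul_assoc,
    ← Matrix.mul_assoc (1 + I • H), hcomm, Matrix.mul_assoc (1 - I • H), Matrix.mul_nonsing_inv _ hu,
    Matrix.mul_one, Matrix.nonsing_inv_mul _ hu']

lemma inv_apply_mem_of_forall_mem {K : IntermediateField ℚ ℂ} {M : Matrix ι ι ℂ}
    (h : ∀ a b, M a b ∈ K) (a b : ι) : M⁻¹ a b ∈ K := by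
  have hdet : ∀ N : Matrix ι ι ℂ, (∀ a b, N a b ∈ K) → N.det ∈ K := by
    intro N hN
    rw [Matrix.det_apply]
    refine sum_mem fun σ _ => ?_
    rw [Units.smul_def]
    exact zsmul_mem (prod_mem fun i _ => hN _ _) _
  rw [Matrix.inv_def, Matrix.smul_apply, Ring.inverse_eq_inv', smul_eq_mul,
    Matrix.adjugate_apply]
  refine mul_mem (inv_mem (hdet M h)) (hdet _ fun i j => ?_)
  rw [Matrix.updateRow_apply]
  split_ifs
  · rw [Pi.single_apply]
    split_ifs
    · exact one_mem K
    · exact zero_mem K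
  · exact h i j

/-- The entries of a Hermitian matrix are rational expressions in the entries of its Cayley
transform and `i`. -/
lemma mem_of_forall_cayleyMatrix_mem {K : IntermediateField ℚ ℂ} {H : Matrix ι ι ℂ} (hH : Hᴴ = H)
    (hI : I ∈ K) (h : ∀ a b, cayleyMatrix H a b ∈ K) (a b : ι) : H a b ∈ K := by
  have hu := (Matrix.isUnit_iff_isUnit_det _).1 (isUnit_one_add_I_smul hH)
  have hone : ∀ a b, (1 : Matrix ι ι ℂ) a b ∈ K := by
    intro a b
    rw [Matrix.one_apply]
    split_ifs
    · exact one_mem K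
    · exact zero_mem K
  have h1 : (1 + cayleyMatrix H) * (1 + I • H) = (2 : ℂ) • (1 : Matrix ι ι ℂ) := by
    rw [cayleyMatrix, add_mul, Matrix.mul_assoc, Matrix.nonsing_inv_mul _ hu, two_smul]
    simp
  -- Hence `1 + iH = 2 (1 + U)⁻¹`.
  have h2 : (1 + cayleyMatrix H)⁻¹ = (2 : ℂ)⁻¹ • (1 + I • H) := by
    refine Matrix.inv_eq_right_inv ?_
    rw [Matrix.mul_smul, h1, smul_smul]
    norm_num
  have h3 := inv_apply_mem_of_forall_mem (M := 1 + cayleyMatrix H)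
    (fun a b => add_mem (hone a b) (h a b)) a b
  rw [h2] at h3
  have h4 : H a b = (2 * ((2 : ℂ)⁻¹ • (1 + I • H)) a b - (1 : Matrix ι ι ℂ) a b) / I := by
    simp
  rw [h4]
  exact div_mem (sub_mem (mul_mem (ofNat_mem K 2) h3) (hone a b)) hI

end GenericTargets

/-! ### From parameters to depth -/

section Numerics

lemma sixteen_mul_add_six_le (n : ℕ) : 16 * n + 6 ≤ 2 ^ n + 80 := by
  rcases lt_or_ge n 5 with h | h
  · interval_cases n <;> norm_num
  · induction n, h using Nat.le_induction with
    | base => norm_num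
    | succ k hk ih =>
      have : 2 ^ 5 ≤ 2 ^ k := Nat.pow_le_pow_right (by norm_num) hk
      rw [pow_succ]
      omega

lemma fiftyFour_mul_lt_two_pow {k : ℕ} (hk : 9 ≤ k) : 54 * k < 2 ^ k := by
  induction k, hk using Nat.le_induction with
  | base => norm_num
  | succ k hk ih =>
    rw [pow_succ]
    omega

/-- From parameter counting to depth. The bound `r ≤ ν d` gives `N / ν = O(d)`, and the light-cone
bound `n + r ≤ n 2 ^ d` gives `n = O(d)`. -/
lemma le_depth_of_le_params {n d ν r N : ℕ} (hd : 1 ≤ d) (hN : 2 ^ n ≤ N)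
    (h : N ≤ 24 * r + 8 * n + 3) (hr : r ≤ ν * d) (hr' : n + r ≤ n * 2 ^ d) :
    (1 / 128 : ℝ) * max (n : ℝ) ((N : ℝ) / (ν : ℝ)) ≤ (d : ℝ) := by
  have hn : n ≤ 128 * d := by
    by_contra! hlt
    obtain ⟨k, rfl⟩ := Nat.exists_eq_add_of_le (show d ≤ n by omega)
    have h1 := fiftyFour_mul_lt_two_pow (k := k) (by omega)
    have h2 : 1 ≤ 2 ^ d := Nat.one_le_two_pow
    have h3 : 2 ^ d * 2 ^ k ≤ 2 ^ d * (27 * (d + k)) := by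
      rw [← pow_add]
      nlinarith
    have h4 := Nat.le_of_mul_le_mul_left h3 (by omega)
    omega
  have hdiv : (N : ℝ) / ν ≤ 128 * d := by
    -- For `ν = 0`, a graph without edges, the quotient is `0`.
    rcases Nat.eq_zero_or_pos ν with rfl | hν
    · simp
    · have hνd : 1 ≤ ν * d := Nat.mul_pos hν hd
      have h1 := sixteen_mul_add_six_le n
      have h2 : N ≤ 128 * d * ν := by
        have : 128 * d * ν = 128 * (ν * d) := by ring
        omega
      rw [div_le_iff₀ (by exact_mod_cast hν)]
      exact_mod_cast h2
  have hn' : (n : ℝ) ≤ 128 * d := by exact_mod_cast hn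
  have := max_le hn' hdiv
  linarith

end Numerics

/-! ### The lower bounds -/

section LowerBounds

open Complex

variable {V : Type*} [Fintype V] [DecidableEq V] {G : SimpleGraph V} {n m ν : ℕ}

lemma Circuit.matrix_eq_one_of_depth_eq_zero {C : Circuit G} (h : C.depth = 0) :
    Circuit.matrix C = 1 := by
  rw [List.length_eq_zero_iff.1 h, Circuit.matrix]

/-- A circuit whose amplitudes determine `k` algebraically independent numbers rationally, with the
help of `i` and `s`, has at least `k / 24 - O(n)` CNOTs in the light cone of its input register. -/
lemma exists_card_le_of_amplitudes (hν : IsMaximumMatchingSize G ν) (e : Fin n ⊕ Fin m ≃ V)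
    (C : Circuit G) {X : Set (Fin n → Fin 2)} {φ : (Fin n → Fin 2) → (Fin n → Fin 2) → ℂ}
    (h : ∀ x ∈ X, Circuit.matrix C *ᵥ withAncilla e (ket x) = withAncilla e (φ x))
    {ι : Type*} [Fintype ι] {t : ι → ℝ} (ht : AlgebraicIndependent ℚ fun i => (t i : ℂ)) (s : ℂ)
    (hφ : ∀ K : IntermediateField ℚ ℂ, I ∈ K → s ∈ K → (∀ x ∈ X, ∀ a, φ x a ∈ K) →
      ∀ i, (t i : ℂ) ∈ K) :
    ∃ r, r ≤ ν * C.depth ∧ n + r ≤ n * 2 ^ C.depth ∧ Fintype.card ι ≤ 24 * r + 8 * n + 3 := by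
  obtain ⟨r, T, hr, hr', hT, hmem⟩ := exists_finset_forall_amplitude_mem_adjoin hν e C h
  refine ⟨r, hr, hr', ?_⟩
  have hsub : ∀ z ∈ insert I (insert s T),
      z ∈ IntermediateField.adjoin ℚ ((insert I (insert s T) : Finset ℂ) : Set ℂ) :=
    fun z hz => IntermediateField.subset_adjoin _ _ (Finset.mem_coe.2 hz)
  have hcard := card_le_card_of_mem_adjoin ht (insert I (insert s T)) <|
    hφ _ (hsub _ (by simp)) (hsub _ (by simp)) fun x hx a =>
      IntermediateField.algebra_adjoin_le_adjoin ℚ _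
        (Algebra.adjoin_mono (Finset.coe_subset.2
          ((Finset.subset_insert _ _).trans (Finset.subset_insert _ _))) (hmem x hx a))
  have h1 := Finset.card_insert_le I (insert s T)
  have h2 := Finset.card_insert_le s T
  omega

lemma exists_state_forall_le_depth (hn : 1 ≤ n) :
    ∃ ψ : (Fin n → Fin 2) → ℂ, IsState ψ ∧
      ∀ {V : Type*} [Fintype V] [DecidableEq V] (G : SimpleGraph V) {m ν : ℕ},
        IsMaximumMatchingSize G ν →
        ∀ (e : Fin n ⊕ Fin m ≃ V) (C : Circuit G), Prepares e C ψ →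
          (1 / 128 : ℝ) * max (n : ℝ) ((2 : ℝ) ^ n / (ν : ℝ)) ≤ (C.depth : ℝ) := by
  obtain ⟨t, ht⟩ := exists_algebraicIndependent_real (Fin n → Fin 2)
  set s : ℝ := Real.sqrt (2 ^ n) with hs
  have hspos : 0 < s := Real.sqrt_pos.2 (by positivity)
  have hs0 : (s : ℂ) ≠ 0 := ofReal_ne_zero.2 hspos.ne'
  refine ⟨fun x => cayley (t x) / s, ?_, ?_⟩
  · have : ∀ x, ‖cayley (t x) / (s : ℂ)‖ ^ 2 = (2 ^ n)⁻¹ := by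
      intro x
      rw [norm_div, norm_cayley, norm_real, Real.norm_of_nonneg hspos.le, div_pow, hs,
        Real.sq_sqrt (by positivity), one_pow, one_div]
    rw [IsState, Finset.sum_congr rfl fun x _ => this x]
    simp
  · intro V _ _ G m ν hν e C hC
    have hd : 1 ≤ C.depth := by
      by_contra! h0
      rw [Prepares, Circuit.matrix_eq_one_of_depth_eq_zero (by omega), Matrix.one_mulVec] at hC
      have h1 := congrFun (withAncilla_injective e hC) (fun _ => 1)
      have hne : (fun _ => 1 : Fin n → Fin 2) ≠ 0 := fun h => by
        simpa using congrFun h ⟨0, hn⟩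
      rw [ket, Pi.single_eq_of_ne hne] at h1
      exact div_ne_zero (cayley_ne_zero _) hs0 h1.symm
    obtain ⟨r, hr, hr', hcard⟩ := exists_card_le_of_amplitudes hν e C (X := {0})
      (φ := fun _ x => cayley (t x) / s) (fun x hx => by rw [Set.mem_singleton_iff.1 hx]; exact hC)
      ht s fun K hI hsK hK x => ofReal_mem_of_cayley_mem hI (by
        have := mul_mem (hK 0 rfl x) hsK
        rwa [div_mul_cancel₀ _ hs0] at this)
    have := le_depth_of_le_params (N := 2 ^ n) hd le_rfl (by simpa using hcard) hr hr'
    exact_mod_cast this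

lemma exists_diagonal_forall_le_depth (hn : 1 ≤ n) :
    ∃ D : Matrix (Fin n → Fin 2) (Fin n → Fin 2) ℂ, IsDiagonalUnitary D ∧
      ∀ {V : Type*} [Fintype V] [DecidableEq V] (G : SimpleGraph V) {m ν : ℕ},
        IsMaximumMatchingSize G ν →
        ∀ (e : Fin n ⊕ Fin m ≃ V) (C : Circuit G), Implements e C D →
          (1 / 128 : ℝ) * max (n : ℝ) ((2 : ℝ) ^ n / (ν : ℝ)) ≤ (C.depth : ℝ) := by
  obtain ⟨t, ht⟩ := exists_algebraicIndependent_real (Fin n → Fin 2)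
  -- Dividing by `cayley (t 0)` makes the entry at `0` equal to `1`; below, this number is
  -- the auxiliary `s` from which the other Cayley transforms are recovered.
  set D : Matrix (Fin n → Fin 2) (Fin n → Fin 2) ℂ :=
    Matrix.diagonal fun x => cayley (t x) / cayley (t 0) with hD
  have hinj : ∀ x, D x x = 1 → x = 0 := by
    intro x hx
    rw [hD, Matrix.diagonal_apply_eq, div_eq_one_iff_eq (cayley_ne_zero _)] at hx
    exact ht.injective (congrArg ofReal (cayley_injective hx))
  refine ⟨D, ⟨?_, Matrix.isDiag_diagonal _, ?_⟩, ?_⟩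
  · rw [Matrix.mem_unitaryGroup_iff', hD, Matrix.star_eq_conjTranspose,
      Matrix.diagonal_conjTranspose, Matrix.diagonal_mul_diagonal, ← Matrix.diagonal_one]
    congr 1
    funext x
    rw [Pi.star_apply, RCLike.star_def, RCLike.conj_mul, norm_div, norm_cayley, norm_cayley]
    simp
  · rw [hD, Matrix.diagonal_apply_eq, div_self (cayley_ne_zero _)]
  · intro V _ _ G m ν hν e C hC
    have hd : 1 ≤ C.depth := by
      by_contra! h0
      rw [Implements, Circuit.matrix_eq_one_of_depth_eq_zero (by omega)] at hC
      have h1 := hC (fun _ => 1)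
      rw [Matrix.one_mulVec] at h1
      have h2 := congrFun (withAncilla_injective e h1) (fun _ => 1)
      rw [ket, Matrix.mulVec_single_one, Pi.single_eq_same] at h2
      simpa using congrFun (hinj _ h2.symm) ⟨0, hn⟩
    obtain ⟨r, hr, hr', hcard⟩ := exists_card_le_of_amplitudes hν e C (X := Set.univ)
      (fun x _ => hC x) ht (cayley (t 0)) fun K hI hsK hK x => ofReal_mem_of_cayley_mem hI (by
        have := hK x trivial x
        rw [ket, Matrix.mulVec_single_one, Matrix.col_apply, hD, Matrix.diagonal_apply_eq] at this
        have := mul_mem this hsK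
        rwa [div_mul_cancel₀ _ (cayley_ne_zero _)] at this)
    have := le_depth_of_le_params (N := 2 ^ n) hd le_rfl (by simpa using hcard) hr hr'
    exact_mod_cast this

lemma exists_unitary_forall_le_depth (hn : 1 ≤ n) :
    ∃ U : Matrix (Fin n → Fin 2) (Fin n → Fin 2) ℂ,
      U ∈ Matrix.unitaryGroup (Fin n → Fin 2) ℂ ∧
      ∀ {V : Type*} [Fintype V] [DecidableEq V] (G : SimpleGraph V) {m ν : ℕ},
        IsMaximumMatchingSize G ν →
        ∀ (e : Fin n ⊕ Fin m ≃ V) (C : Circuit G), Implements e C U →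
          (1 / 128 : ℝ) * max (n : ℝ) ((4 : ℝ) ^ n / (ν : ℝ)) ≤ (C.depth : ℝ) := by
  obtain ⟨t, ht⟩ := exists_algebraicIndependent_real ((Fin n → Fin 2) × (Fin n → Fin 2))
  have hH := isHermitian_hermitianOf t
  refine ⟨cayleyMatrix (hermitianOf t), cayleyMatrix_mem_unitaryGroup hH, ?_⟩
  intro V _ _ G m ν hν e C hC
  have hrec : ∀ K : IntermediateField ℚ ℂ, I ∈ K →
      (∀ x a, cayleyMatrix (hermitianOf t) a x ∈ K) → ∀ p, (t p : ℂ) ∈ K :=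
    fun K hI hK => ofReal_mem_of_forall_hermitianOf_mem hI
      (mem_of_forall_cayleyMatrix_mem hH hI fun a b => hK b a)
  have hd : 1 ≤ C.depth := by
    by_contra! h0
    rw [Implements, Circuit.matrix_eq_one_of_depth_eq_zero (by omega)] at hC
    have hone : cayleyMatrix (hermitianOf t) = 1 := by
      ext a x
      have h1 := hC x
      rw [Matrix.one_mulVec] at h1
      have h2 := congrFun (withAncilla_injective e h1) a
      rw [ket, Matrix.mulVec_single_one, Matrix.col_apply] at h2
      rw [← h2, Matrix.one_apply, Pi.single_apply]
    -- The numbers `t` would all lie in `ℚ(i)`, a field generated by a single number.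
    have hcard := card_le_card_of_mem_adjoin ht {I} <|
      hrec _ (IntermediateField.subset_adjoin _ _ (by simp)) fun x a => by
        rw [hone, Matrix.one_apply]
        split_ifs
        · exact one_mem _
        · exact zero_mem _
    have : 2 ^ 1 ≤ 2 ^ n := Nat.pow_le_pow_right (by norm_num) hn
    simp at hcard
    nlinarith
  obtain ⟨r, hr, hr', hcard⟩ := exists_card_le_of_amplitudes hν e C (X := Set.univ)
    (fun x _ => hC x) ht 0 fun K hI _ hK => hrec K hI fun x a => by
      have := hK x trivial a
      rwa [ket, Matrix.mulVec_single_one, Matrix.col_apply] at this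
  have h4 : Fintype.card ((Fin n → Fin 2) × (Fin n → Fin 2)) = 4 ^ n := by
    simp [← mul_pow]
  have := le_depth_of_le_params (N := 4 ^ n) hd (Nat.pow_le_pow_left (by norm_num) n)
    (h4 ▸ hcard) hr hr'
  exact_mod_cast this

end LowerBounds

end QCircuit

theorem mainTheorem9 :
    ∃ c : ℝ, 0 < c ∧
      ∀ (n m : ℕ), 1 ≤ n → 2 ≤ n + m →
      ∀ (V : Type*) [Fintype V] [DecidableEq V] (G : SimpleGraph V) (ν : ℕ),
        Fintype.card V = n + m → G.Connected → QCircuit.IsMaximumMatchingSize G ν →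
        -- quantum states
        (∃ ψ : (Fin n → Fin 2) → ℂ, QCircuit.IsState ψ ∧
          ∀ (e : Fin n ⊕ Fin m ≃ V) (C : QCircuit.Circuit G), QCircuit.Prepares e C ψ →
            c * max (n : ℝ) ((2 : ℝ) ^ n / (ν : ℝ)) ≤ (C.depth : ℝ)) ∧
        -- diagonal unitary matrices
        (∃ D : Matrix (Fin n → Fin 2) (Fin n → Fin 2) ℂ, QCircuit.IsDiagonalUnitary D ∧
          ∀ (e : Fin n ⊕ Fin m ≃ V) (C : QCircuit.Circuit G), QCircuit.Implements e C D →
            c * max (n : ℝ) ((2 : ℝ) ^ n / (ν : ℝ)) ≤ (C.depth : ℝ)) ∧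
        -- general unitary matrices
        (∃ U : Matrix (Fin n → Fin 2) (Fin n → Fin 2) ℂ,
          U ∈ Matrix.unitaryGroup (Fin n → Fin 2) ℂ ∧
          ∀ (e : Fin n ⊕ Fin m ≃ V) (C : QCircuit.Circuit G), QCircuit.Implements e C U →
            c * max (n : ℝ) ((4 : ℝ) ^ n / (ν : ℝ)) ≤ (C.depth : ℝ)) := by
  refine ⟨1 / 128, by norm_num, fun n m hn _ V _ _ G ν _ _ hν => ?_⟩
  obtain ⟨ψ, hψ, hψ'⟩ := QCircuit.exists_state_forall_le_depth hn
  obtain ⟨D, hD, hD'⟩ := QCircuit.exists_diagonal_forall_le_depth hn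
  obtain ⟨U, hU, hU'⟩ := QCircuit.exists_unitary_forall_le_depth hn
  exact ⟨⟨ψ, hψ, hψ' G hν⟩, ⟨D, hD, hD' G hν⟩, ⟨U, hU, hU' G hν⟩⟩
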